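/- Let $|+_\theta\rangle=\frac1{\sqrt2}(|0\rangle+e^{i\theta}|1\rangle)$. Let $\mathcal S=\mathcal S_{\mathbb Z\frac\pi2}$ be the two-interface resource that takes no input, draws $\theta$ uniformly from $\{0,\frac\pi2,\pi,\frac{3\pi}2\}$, outputs the classical value $\theta$ on its left (client) interface and the qubit $|+_\theta\rangle$ on its right (server) interface. All systems are finite-dimensional. A converter is an interactive machine with a quantum memory that exchanges a bounded number of classical bit-string messages, each round being a quantum instrument on its memory. A client $\pi_A$ finally outputs a classical value in $\{0,\frac\pi2,\pi,\frac{3\pi}2\}$ on its outer interface; a server $\pi_B$ finally outputs a qubit on its outer interface; a simulator $\sigma$ receives one qubit on its inner interface and exchanges classical messages on its outer interface. Let $\mathcal C$ be the classical channel between client and server, which forwards classical messages. For two resources write $\mathcal R\approx_\varepsilon\mathcal R'$ if for every distinguisher, i.e. every quantum machine that interacts with the right interface, obtains the output of the left interface, and outputs a bit, the probabilities of output $1$ for $\mathcal R$ and for $\mathcal R'$ differ by at most $\varepsilon$. The resource $\mathcal S$ is *$\varepsilon$-classically-realizable* if there are converters $\pi_A,\pi_B$ with $\pi_A\mathcal C\pi_B\approx_\varepsilon\mathcal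 S$ (availability) and a simulator $\sigma$ with $\pi_A\mathcal C\approx_\varepsilon\mathcal S\sigma$ (security). In the *information-theoretic* sense, all converters and distinguishers are arbitrary (unbounded). In the *computational* sense, where $\varepsilon=\varepsilon(n)$ may depend on a security parameter $n$, the converters and distinguishers are non-uniform families, indexed by $n$, of quantum circuits (over a fixed finite universal gate set) of size polynomial in $n$, and for each family of distinguishers the two bounds on the difference have to hold with $\varepsilon(n)$ for all sufficiently large $n$. **Lemma.** There exists a universal constant $\eta>0$ such that 1. for all $0\le\varepsilon<\eta$ the resource $\mathcal S_{\mathbb Z\frac\pi2}$ is not $\varepsilon$-classically-realizable in the information-theoretic sense; 2. for every $\varepsilon:\mathbb N\to[0,\infty)$ with $\varepsilon(n)<\eta$ for infinitely many $n$ (in particular for every constant $0\le\varepsilon<\eta$) the resource $\mathcal S_{\mathbb Z\frac\pi2}$ is not $\varepsilon$-classically-realizable in the computational sense. -/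

import Mathlib

open scoped Matrix ComplexOrder

noncomputable section

namespace RSP

/-! ### Channels, instruments, effects on finite-dimensional systems -/

/-- The map `id_k ⊗ Φ` on `k × k` block matrices. -/
def ampliate {H O : Type} (k : ℕ) (Φ : Matrix H H ℂ →ₗ[ℂ] Matrix O O ℂ)
    (X : Matrix (Fin k × H) (Fin k × H) ℂ) : Matrix (Fin k × O) (Fin k × O) ℂ :=
  Matrix.of fun p q => Φ (Matrix.of fun a b => X (p.1, a) (q.1, b)) p.2 q.2

/-- Complete positivity: every ampliation `id_k ⊗ Φ` preserves positive semidefiniteness. -/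
def IsCP {H O : Type} (Φ : Matrix H H ℂ →ₗ[ℂ] Matrix O O ℂ) : Prop :=
  ∀ (k : ℕ) (X : Matrix (Fin k × H) (Fin k × H) ℂ), X.PosSemidef → (ampliate k Φ X).PosSemidef

/-- A quantum instrument with classical outcome `y`: on input `ρ` the outcome `y` has probability
`tr (E y ρ)` and leaves the (unnormalised) state `E y ρ`. -/
def IsInstrument {Y H O : Type} [Fintype Y] [Fintype H] [Fintype O]
    (E : Y → (Matrix H H ℂ →ₗ[ℂ] Matrix O O ℂ)) : Prop :=
  (∀ y, IsCP (E y)) ∧ ∀ ρ, ∑ y, (E y ρ).trace = ρ.trace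

/-- A quantum channel: completely positive and trace preserving. -/
def IsChannel {H O : Type} [Fintype H] [Fintype O]
    (Φ : Matrix H H ℂ →ₗ[ℂ] Matrix O O ℂ) : Prop :=
  IsCP Φ ∧ ∀ ρ, (Φ ρ).trace = ρ.trace

/-- An effect, i.e. one element of a two-outcome POVM: `0 ≤ E ≤ 1`. -/
def IsEffect {H : Type} [Fintype H] [DecidableEq H] (E : Matrix H H ℂ) : Prop :=
  E.PosSemidef ∧ (1 - E).PosSemidef

/-! ### Ideal resources -/

/-- A two-interface resource without inputs which outputs a classical value `k : Fin 4` on the left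
interface and one qubit on the right interface. `state k` is the right qubit, weighted by the
probability of the left output `k` (a classical-quantum state). -/
structure IdealResource where
  state : Fin 4 → Matrix Bool Bool ℂ
  pos : ∀ k, (state k).PosSemidef
  trace_sum : ∑ k, (state k).trace = 1

/-- The angle `kπ/2`, for `k = 0, 1, 2, 3`. -/
def angle (k : Fin 4) : ℝ := (k : ℕ) * (Real.pi / 2)

/-- `|+_θ⟩ = (|0⟩ + e^{iθ}|1⟩)/√2`; `false`, `true` stand for the basis states `0`, `1`. -/
def plusKet (θ : ℝ) : Bool → ℂ
  | false => (1 / √2 : ℝ)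
  | true => (1 / √2 : ℝ) * Complex.exp (θ * Complex.I)

/-- `|+_θ⟩⟨+_θ|`. -/
def plusProj (θ : ℝ) : Matrix Bool Bool ℂ :=
  Matrix.vecMulVec (plusKet θ) (star (plusKet θ))

lemma plusProj_posSemidef (θ : ℝ) : (plusProj θ).PosSemidef :=
  Matrix.posSemidef_vecMulVec_self_star _

lemma plusProj_trace (θ : ℝ) : (plusProj θ).trace = 1 := by
  have h : ((1 / √2 : ℝ) : ℂ) * ((1 / √2 : ℝ) : ℂ) = 1 / 2 := by
    rw [← Complex.ofReal_mul, ← pow_two, div_pow, Real.sq_sqrt (by norm_num)]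
    norm_num
  have h2 : Complex.exp (θ * Complex.I) * (starRingEnd ℂ) (Complex.exp (θ * Complex.I)) = 1 := by
    rw [Complex.mul_conj, Complex.normSq_eq_norm_sq, Complex.norm_exp_ofReal_mul_I]
    norm_num
  simp only [plusProj, Matrix.trace, Matrix.diag_apply, Matrix.vecMulVec_apply, Fintype.sum_bool,
    Pi.star_apply, plusKet, RCLike.star_def, map_mul, Complex.conj_ofReal]
  linear_combination h + ((1 / √2 : ℝ) : ℂ) * ((1 / √2 : ℝ) : ℂ) * h2 + h

/-- The resource that draws `θ` uniformly from `{0, π/2, π, 3π/2}`, outputs `θ` on the left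
interface and `|+_θ⟩` on the right interface. -/
def SZpi2 : IdealResource where
  state k := (1 / 4 : ℂ) • plusProj (angle k)
  pos k := (plusProj_posSemidef _).smul (by positivity)
  trace_sum := by simp [Matrix.trace_smul, plusProj_trace]

/-! ### Interactive quantum machines exchanging classical messages -/

/-- Classical messages are bit strings of a fixed length; the zero string is also the dummy
message. -/
abbrev Msg (ℓ : ℕ) : Type := Fin ℓ → Bool

/-- An interactive quantum machine with quantum input space `I` and memory `H`. It first absorbs its
quantum input; in round `i` it receives a classical message `x`, applies to its memory the quantum
instrument `step i x`, and sends the classical outcome `y`. -/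
structure Machine (ℓ N : ℕ) (I H : Type) [Fintype I] [Fintype H] where
  init : Matrix I I ℂ →ₗ[ℂ] Matrix H H ℂ
  init_channel : IsChannel init
  step : Fin N → Msg ℓ → Msg ℓ → (Matrix H H ℂ →ₗ[ℂ] Matrix H H ℂ)
  step_instrument : ∀ i x, IsInstrument (step i x)

/-- The unnormalised memory state after all rounds, on input state `ρ`, when the messages received
are `recv` and the messages sent are `sent`. -/
def Machine.run {ℓ N : ℕ} {I H : Type} [Fintype I] [Fintype H] (M : Machine ℓ N I H)
    (ρ : Matrix I I ℂ) (recv sent : Fin N → Msg ℓ) : Matrix H H ℂ :=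
  Fin.foldl N (fun s i => M.step i (recv i) (sent i) s) (M.init ρ)

/-- A client converter: it interacts classically on its inner interface, and finally outputs a
classical value `k : Fin 4` on its outer interface by measuring the POVM `readout`. -/
structure Client (ℓ N : ℕ) (H : Type) [Fintype H] [DecidableEq H] extends
    Machine ℓ N Unit H where
  readout : Fin 4 → Matrix H H ℂ
  readout_pos : ∀ k, (readout k).PosSemidef
  readout_sum : ∑ k, readout k = 1

/-- A server converter: it interacts classically on its inner interface, and finally outputs a qubit
on its outer interface. -/
structure Server (ℓ N : ℕ) (H : Type) [Fintype H] extends Machine ℓ N Unit H where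
  output : Matrix H H ℂ →ₗ[ℂ] Matrix Bool Bool ℂ
  output_channel : IsChannel output

/-- A simulator: it receives the qubit from the right interface of the ideal resource on its inner
interface, and interacts classically on its outer interface. -/
abbrev Simulator (ℓ N : ℕ) (H : Type) [Fintype H] : Type := Machine ℓ N Bool H

/-- A distinguisher for resources with a left classical output and a right classical interactive
interface: it interacts with the right interface, then obtains the left output `k`, and finally
outputs the bit `1` according to the effect `accept k` on its memory. -/
structure Distinguisher (ℓ N : ℕ) (H : Type) [Fintype H] [DecidableEq H] extends
    Machine ℓ N Unit H where
  accept : Fin 4 → Matrix H H ℂ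
  accept_effect : ∀ k, IsEffect (accept k)

/-! ### Composition of resources and converters

Over the classical channel the two sides speak alternately. In round `i` the left side
sends `x i`, after having received the previous message of the right side (the dummy
message in round `0`), and the right side receives `x i` and sends `y i`. The right side's message
in the last round is not used by the left side (a protocol that needs it has one more round). For
fixed messages the two sides evolve independently, so joint probabilities are sums over transcripts
of products. -/

/-- What the left side receives in each round if the right side sends `y`. -/
def delayed {ℓ N : ℕ} (y : Fin N → Msg ℓ) (i : Fin N) : Msg ℓ :=
  (Fin.cons (fun _ => false) y : Fin (N + 1) → Msg ℓ) i.castSucc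

/-- A resource whose left interface outputs `k : Fin 4` and whose right interface is classical and
interactive, given by its behaviour: `p k x y` is the probability that it sends the messages `x` on
the right interface and outputs `k` on the left interface, when the messages that it receives on the
right interface are `y`. -/
abbrev LinkBehaviour (ℓ N : ℕ) : Type :=
  Fin 4 → (Fin N → Msg ℓ) → (Fin N → Msg ℓ) → ℝ

/-- The resource `π_A C`: the client connected to the classical channel. -/
def Client.link {ℓ N : ℕ} {H : Type} [Fintype H] [DecidableEq H] (πA : Client ℓ N H) :
    LinkBehaviour ℓ N :=
  fun k x y => (πA.readout k * πA.run 1 (delayed y) x).trace.re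

/-- The resource `S σ`: the simulator connected to the right interface of `S`. -/
def IdealResource.link {ℓ N : ℕ} {H : Type} [Fintype H] (S : IdealResource)
    (σ : Simulator ℓ N H) : LinkBehaviour ℓ N :=
  fun k x y => (σ.run (S.state k) (delayed y) x).trace.re

/-- The resource `R π_B`: the server connected to the right interface of `R`; the result is the
classical-quantum state of the left output and the right output qubit. -/
def LinkBehaviour.attach {ℓ N : ℕ} {H : Type} [Fintype H] (p : LinkBehaviour ℓ N)
    (πB : Server ℓ N H) : Fin 4 → Matrix Bool Bool ℂ :=
  fun k => ∑ x : Fin N → Msg ℓ, ∑ y : Fin N → Msg ℓ, (p k x y : ℂ) • πB.output (πB.run 1 x y)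

/-- The probability that the distinguisher outputs `1` when it interacts with the resource `p`. -/
def Distinguisher.prob {ℓ N : ℕ} {H : Type} [Fintype H] [DecidableEq H]
    (D : Distinguisher ℓ N H) (p : LinkBehaviour ℓ N) : ℝ :=
  ∑ k, ∑ x : Fin N → Msg ℓ, ∑ y : Fin N → Msg ℓ, p k x y * (D.accept k * D.run 1 x y).trace.re

/-- The probability that a distinguisher for resources with a classical left output and a right
output qubit outputs `1`: having obtained `k` it measures the effect `E k` on the qubit. -/
def cqProb (E : Fin 4 → Matrix Bool Bool ℂ) (ρ : Fin 4 → Matrix Bool Bool ℂ) : ℝ :=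
  ∑ k, (E k * ρ k).trace.re

/-! ### Realizability against unbounded distinguishers -/

/-- `S` is `ε`-classically-realizable in the information-theoretic sense: all systems are arbitrary
finite-dimensional quantum systems. The two conditions are availability, `π_A C π_B ≈_ε S`, and
security, `π_A C ≈_ε S σ` for some simulator `σ`. -/
def ITRealizable (S : IdealResource) (ε : ℝ) : Prop :=
  ∃ (ℓ N dA dB : ℕ) (πA : Client ℓ N (Fin dA)) (πB : Server ℓ N (Fin dB)),
    (∀ E : Fin 4 → Matrix Bool Bool ℂ, (∀ k, IsEffect (E k)) →
      |cqProb E (πA.link.attach πB) - cqProb E S.state| ≤ ε) ∧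
    ∃ (dS : ℕ) (σ : Simulator ℓ N (Fin dS)),
      ∀ (dD : ℕ) (D : Distinguisher ℓ N (Fin dD)),
        |D.prob πA.link - D.prob (S.link σ)| ≤ ε

/-! ### Quantum circuits -/

/-- The gates Hadamard, `T = diag(1, e^{iπ/4})`, and controlled not, on a set `W` of wires. -/
inductive Gate (W : Type) : Type
  | had (w : W)
  | t (w : W)
  | cnot (c w : W) (h : c ≠ w)

/-- The matrix of the Hadamard gate on one qubit. -/
def hadEntry (a b : Bool) : ℂ := (if a && b then -1 else 1) * (1 / √2 : ℝ)

/-- The unitary matrix of a gate on the qubits `W`. The entry at `(f, g)` is the amplitude of the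
basis state `f` in the image of the basis state `g`. -/
def Gate.mat {W : Type} [DecidableEq W] [Fintype W] :
    Gate W → Matrix (W → Bool) (W → Bool) ℂ
  | .had w => Matrix.of fun f g =>
      if f = Function.update g w (f w) then hadEntry (f w) (g w) else 0
  | .t w => Matrix.diagonal fun f =>
      if f w then Complex.exp ((Real.pi / 4 : ℝ) * Complex.I) else 1
  | .cnot c w _ => Matrix.of fun f g =>
      if f = Function.update g w (xor (g c) (g w)) then 1 else 0

/-- A circuit is a list of gates; the head of the list is applied first. -/
abbrev Circuit (W : Type) : Type := List (Gate W)

/-- The unitary matrix of a circuit. -/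
def Circuit.mat {W : Type} [DecidableEq W] [Fintype W] :
    Circuit W → Matrix (W → Bool) (W → Bool) ℂ
  | [] => 1
  | g :: c => Circuit.mat c * g.mat

lemma Gate.mat_unitary {W : Type} [DecidableEq W] [Fintype W] (g : Gate W) :
    g.matᴴ * g.mat = 1 := by
  have hs : ((1 / √2 : ℝ) : ℂ) * ((1 / √2 : ℝ) : ℂ) = 1 / 2 := by
    rw [← Complex.ofReal_mul, ← pow_two, div_pow, Real.sq_sqrt (by norm_num)]
    norm_num
  cases g with
  | had w =>
    have hM : ∀ e f : W → Bool, Gate.mat (.had w) e f =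
        ∑ b : Bool, if e = Function.update f w b then hadEntry b (f w) else 0 := by
      intro e f
      have h1 : ∀ b, e = Function.update f w b → e w = b := fun b h => by rw [h]; simp
      simp only [Gate.mat, Matrix.of_apply]
      rw [Finset.sum_eq_single (e w)]
      · intro b _ hb
        exact if_neg fun h => hb (h1 b h).symm
      · simp
    have hr : ∀ a b, star (hadEntry a b) = hadEntry a b := by
      intro a b
      cases a <;> cases b <;> simp [hadEntry]
    ext f g
    have key : (((Gate.mat (.had w))ᴴ * Gate.mat (.had w)) f g : ℂ) =
        ∑ b : Bool, hadEntry b (f w) * Gate.mat (.had w) (Function.update f w b) g := by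
      simp only [Matrix.mul_apply, Matrix.conjTranspose_apply]
      simp_rw [hM _ f, star_sum, Finset.sum_mul]
      rw [Finset.sum_comm]
      refine Finset.sum_congr rfl fun b _ => ?_
      simp_rw [apply_ite star, hr, star_zero, ite_mul, zero_mul]
      simp
    rw [key]
    simp only [Gate.mat, Matrix.of_apply, Function.update_self, Matrix.one_apply]
    by_cases hfg : ∀ v, v ≠ w → f v = g v
    · have hu : ∀ b, Function.update f w b = Function.update g w b := fun b => by
        ext v
        by_cases hv : v = w
        · subst hv; simp
        · simp [hv, hfg v hv]
      have hiff : f = g ↔ f w = g w := ⟨fun h => by rw [h], fun h => by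
        ext v
        by_cases hv : v = w
        · subst hv; rw [h]
        · rw [hfg v hv]⟩
      simp only [hu, if_true, hiff, Fintype.sum_bool]
      rcases f w <;> rcases g w <;> simp [hadEntry] <;> simp at hs <;> linear_combination 2 * hs
    · have hu : ∀ b, Function.update f w b ≠ Function.update g w b := fun b h => hfg fun v hv => by
        have := congrFun h v
        simpa [hv] using this
      have hne : f ≠ g := fun h => hfg fun v _ => by rw [h]
      simp [hu, hne]
  | t w =>
    simp only [Gate.mat, Matrix.diagonal_conjTranspose, Matrix.diagonal_mul_diagonal]
    rw [← Matrix.diagonal_one]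
    congr 1
    ext f
    simp only [Pi.star_apply]
    split_ifs
    · rw [RCLike.star_def, mul_comm, Complex.mul_conj, Complex.normSq_eq_norm_sq,
        Complex.norm_exp_ofReal_mul_I]
      norm_num
    · simp
  | cnot c w h =>
    have hinj : ∀ f g : W → Bool, Function.update f w (xor (f c) (f w)) =
        Function.update g w (xor (g c) (g w)) → f = g := by
      intro f g hfg
      have h0 : ∀ v, v ≠ w → f v = g v := fun v hv => by
        have := congrFun hfg v
        simpa [hv] using this
      have h1 := congrFun hfg w
      ext v
      by_cases hv : v = w
      · subst hv
        simpa [h0 c h] using h1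
      · rw [h0 v hv]
    ext f g
    simp only [Gate.mat, Matrix.mul_apply, Matrix.conjTranspose_apply, Matrix.of_apply,
      apply_ite star, star_one, star_zero, ite_mul, one_mul, zero_mul, Finset.sum_ite_eq',
      Finset.mem_univ, if_true, Matrix.one_apply]
    by_cases hfg : f = g
    · simp [hfg]
    · rw [if_neg fun e => hfg (hinj _ _ e), if_neg hfg]

lemma Circuit.mat_unitary {W : Type} [DecidableEq W] [Fintype W] (c : Circuit W) :
    (Circuit.mat c)ᴴ * Circuit.mat c = 1 := by
  induction c with
  | nil => simp [Circuit.mat]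
  | cons g c ih =>
    rw [Circuit.mat, Matrix.conjTranspose_mul, Matrix.mul_assoc, ← Matrix.mul_assoc _ _ g.mat, ih,
      Matrix.one_mul, g.mat_unitary]

/-! ### Machines given by circuits -/

/-- The linear map `ρ ↦ K ρ Kᴴ`. -/
def conjBy {H O : Type} [Fintype H] (K : Matrix O H ℂ) : Matrix H H ℂ →ₗ[ℂ] Matrix O O ℂ where
  toFun ρ := K * ρ * Kᴴ
  map_add' a b := by rw [Matrix.mul_add, Matrix.add_mul]
  map_smul' c a := by simp

lemma isCP_conjBy {H O : Type} [Fintype H] [Fintype O] (K : Matrix O H ℂ) : IsCP (conjBy K) := by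
  intro k X hX
  have : ampliate k (conjBy K) X =
      Matrix.kroneckerMap (· * ·) (1 : Matrix (Fin k) (Fin k) ℂ) K * X *
        (Matrix.kroneckerMap (· * ·) (1 : Matrix (Fin k) (Fin k) ℂ) K)ᴴ := by
    ext p q
    simp [ampliate, conjBy, Matrix.mul_apply, Fintype.sum_prod_type, Matrix.one_apply,
      apply_ite, ite_mul]
  rw [this]
  exact hX.mul_mul_conjTranspose_same _

lemma isInstrument_conjBy {Y H O : Type} [Fintype Y] [Fintype H] [DecidableEq H] [Fintype O]
    (K : Y → Matrix O H ℂ) (hK : ∑ y, (K y)ᴴ * K y = 1) :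
    IsInstrument fun y => conjBy (K y) := by
  refine ⟨fun y => isCP_conjBy _, fun ρ => ?_⟩
  have : ∀ y, (conjBy (K y) ρ).trace = ((K y)ᴴ * K y * ρ).trace := fun y => by
    rw [Matrix.mul_assoc, ← Matrix.trace_mul_comm]
    simp [conjBy]
  simp_rw [this]
  rw [← Matrix.trace_sum, ← Finset.sum_mul, hK, Matrix.one_mul]

lemma isChannel_conjBy {H O : Type} [Fintype H] [DecidableEq H] [Fintype O]
    (V : Matrix O H ℂ) (hV : Vᴴ * V = 1) : IsChannel (conjBy V) := by
  refine ⟨isCP_conjBy _, fun ρ => ?_⟩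
  have := (isInstrument_conjBy (Y := Unit) (fun _ => V) (by simpa using hV)).2 ρ
  simpa using this

/-- The Kraus operator of the following operation on the memory qubits `P`: append the message
register in the basis state `x`, apply the circuit, measure the message register in the computational
basis with outcome `y`. -/
def roundKraus {P : Type} [DecidableEq P] [Fintype P] {ℓ : ℕ} (c : Circuit (P ⊕ Fin ℓ))
    (x y : Msg ℓ) : Matrix (P → Bool) (P → Bool) ℂ :=
  Matrix.of fun a b => Circuit.mat c (Sum.elim a y) (Sum.elim b x)

lemma roundKraus_sum {P : Type} [DecidableEq P] [Fintype P] {ℓ : ℕ} (c : Circuit (P ⊕ Fin ℓ))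
    (x : Msg ℓ) : ∑ y, (roundKraus c x y)ᴴ * roundKraus c x y = 1 := by
  ext a b
  have h := congrFun (congrFun (Circuit.mat_unitary c) (Sum.elim a x)) (Sum.elim b x)
  rw [Matrix.mul_apply, ← (Equiv.sumArrowEquivProdArrow P (Fin ℓ) Bool).symm.sum_comp,
    Fintype.sum_prod_type, Finset.sum_comm] at h
  simp only [Matrix.sum_apply, Matrix.mul_apply]
  refine Eq.trans h ?_
  have : (Sum.elim a x : _ → Bool) = Sum.elim b x ↔ a = b :=
    ⟨fun e => by ext i; exact congrFun e (Sum.inl i), fun e => by rw [e]⟩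
  simp [Matrix.one_apply, this]

/-- A machine given by circuits. It has `m + 2` memory qubits and runs in each round a circuit on the
memory qubits and a message register of `ℓ` qubits. -/
structure CircuitMachine (ℓ N : ℕ) where
  m : ℕ
  rounds : Fin N → Circuit (Fin (m + 2) ⊕ Fin ℓ)

/-- Basis states of the memory of a circuit machine. -/
abbrev CircuitMachine.Mem {ℓ N : ℕ} (M : CircuitMachine ℓ N) : Type := Fin (M.m + 2) → Bool

/-- The size: number of qubits plus number of rounds plus number of gates. -/
def CircuitMachine.size {ℓ N : ℕ} (M : CircuitMachine ℓ N) : ℕ :=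
  M.m + 2 + ℓ + N + ∑ i, (M.rounds i).length

/-- The isometry that prepares `n` qubits in the state `|0…0⟩`. -/
def zeroIso (n : ℕ) : Matrix (Fin n → Bool) Unit ℂ :=
  Matrix.of fun f _ => if f = fun _ => false then 1 else 0

/-- The isometry that puts a qubit on wire `0`, and `n` further qubits in the state `|0…0⟩`. -/
def qubitIso (n : ℕ) : Matrix (Fin (n + 1) → Bool) Bool ℂ :=
  Matrix.of fun f b => if f = Fin.cons b (fun _ => false) then 1 else 0

lemma zeroIso_isometry (n : ℕ) : (zeroIso n)ᴴ * zeroIso n = 1 := by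
  ext a b
  simp [zeroIso, Matrix.mul_apply]

lemma qubitIso_isometry (n : ℕ) : (qubitIso n)ᴴ * qubitIso n = 1 := by
  ext a b
  simp [qubitIso, Matrix.mul_apply, Matrix.one_apply, eq_comm]

/-- The interactive machine of a circuit machine without quantum input. -/
def CircuitMachine.toMachine {ℓ N : ℕ} (M : CircuitMachine ℓ N) : Machine ℓ N Unit M.Mem where
  init := conjBy (zeroIso _)
  init_channel := isChannel_conjBy _ (zeroIso_isometry _)
  step i x y := conjBy (roundKraus (M.rounds i) x y)
  step_instrument i x := isInstrument_conjBy _ (roundKraus_sum (M.rounds i) x)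

/-- A circuit machine as a simulator: the qubit from the ideal resource is put on wire `0`. -/
def CircuitMachine.toSimulator {ℓ N : ℕ} (M : CircuitMachine ℓ N) : Simulator ℓ N M.Mem where
  init := conjBy (qubitIso _)
  init_channel := isChannel_conjBy _ (qubitIso_isometry _)
  step i x y := conjBy (roundKraus (M.rounds i) x y)
  step_instrument i x := isInstrument_conjBy _ (roundKraus_sum (M.rounds i) x)

/-- The projection onto the basis states that satisfy `p`. -/
def basisProj {H : Type} [DecidableEq H] (p : H → Prop) [DecidablePred p] : Matrix H H ℂ :=
  Matrix.diagonal fun a => if p a then 1 else 0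

lemma basisProj_effect {H : Type} [Fintype H] [DecidableEq H] (p : H → Prop) [DecidablePred p] :
    IsEffect (basisProj p) := by
  constructor
  · refine Matrix.PosSemidef.diagonal fun a => ?_
    dsimp only
    split_ifs <;> simp
  · rw [basisProj, ← Matrix.diagonal_one, Matrix.diagonal_sub]
    refine Matrix.PosSemidef.diagonal fun a => ?_
    dsimp only
    split_ifs <;> simp

lemma isEffect_conj {H O : Type} [Fintype H] [DecidableEq H] [Fintype O] [DecidableEq O]
    {E : Matrix O O ℂ} (hE : IsEffect E) (V : Matrix O H ℂ) (hV : Vᴴ * V = 1) :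
    IsEffect (Vᴴ * E * V) := by
  refine ⟨hE.1.conjTranspose_mul_mul_same V, ?_⟩
  have : 1 - Vᴴ * E * V = Vᴴ * (1 - E) * V := by
    rw [Matrix.mul_sub, Matrix.sub_mul, Matrix.mul_one, hV]
  rw [this]
  exact hE.2.conjTranspose_mul_mul_same V

/-- The number `2 b₁ + b₀` encoded by two bits. -/
def bitsToFin (b₀ b₁ : Bool) : Fin 4 :=
  if b₁ then (if b₀ then 3 else 2) else (if b₀ then 1 else 0)

/-- A circuit machine as a client: in the end it measures wires `0` and `1`. -/
def CircuitMachine.toClient {ℓ N : ℕ} (M : CircuitMachine ℓ N) : Client ℓ N M.Mem where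
  toMachine := M.toMachine
  readout k := basisProj fun a : M.Mem => bitsToFin (a 0) (a 1) = k
  readout_pos _ := (basisProj_effect _).1
  readout_sum := by
    ext a b
    by_cases h : a = b
    · subst h
      simp [basisProj, Matrix.sum_apply]
    · simp [basisProj, Matrix.sum_apply, h]

/-- The partial trace over all wires except wire `0`. -/
def keepFirst (n : ℕ) :
    Matrix (Fin (n + 1) → Bool) (Fin (n + 1) → Bool) ℂ →ₗ[ℂ] Matrix Bool Bool ℂ where
  toFun ρ := Matrix.of fun b b' => ∑ r : Fin n → Bool, ρ (Fin.cons b r) (Fin.cons b' r)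
  map_add' a b := by ext; simp [Finset.sum_add_distrib]
  map_smul' c a := by ext; simp [Finset.mul_sum]

lemma keepFirst_channel (n : ℕ) : IsChannel (keepFirst n) := by
  constructor
  · intro k X hX
    have : ampliate k (keepFirst n) X = ∑ r : Fin n → Bool,
        X.submatrix (fun p : Fin k × Bool => (p.1, (Fin.cons p.2 r : Fin (n + 1) → Bool)))
          (fun p : Fin k × Bool => (p.1, (Fin.cons p.2 r : Fin (n + 1) → Bool))) := by
      ext p q
      simp [ampliate, keepFirst, Matrix.sum_apply]
    rw [this]
    exact Matrix.posSemidef_sum _ fun r _ => hX.submatrix _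
  · intro ρ
    simp only [Matrix.trace, Matrix.diag_apply, keepFirst, LinearMap.coe_mk, AddHom.coe_mk,
      Matrix.of_apply]
    rw [← (Fin.consEquiv fun _ : Fin (n + 1) => Bool).sum_comp, Fintype.sum_prod_type]
    rfl

/-- A circuit machine as a server: in the end it outputs the qubit on wire `0`. -/
def CircuitMachine.toServer {ℓ N : ℕ} (M : CircuitMachine ℓ N) : Server ℓ N M.Mem where
  toMachine := M.toMachine
  output := keepFirst _
  output_channel := keepFirst_channel _

/-- The effect on the qubits `W`: apply the circuit, and accept if the wire `w` is measured as `1`. -/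
def acceptEffect {W : Type} [DecidableEq W] [Fintype W] (c : Circuit W) (w : W) :
    Matrix (W → Bool) (W → Bool) ℂ :=
  (Circuit.mat c)ᴴ * basisProj (fun a : W → Bool => a w = true) * Circuit.mat c

lemma acceptEffect_effect {W : Type} [DecidableEq W] [Fintype W] (c : Circuit W) (w : W) :
    IsEffect (acceptEffect c w) :=
  isEffect_conj (basisProj_effect _) _ (Circuit.mat_unitary c)

/-- A distinguisher given by circuits: after the interaction and after having obtained the left
output `k`, it runs the circuit `final k` on its memory qubits, measures wire `0` and outputs the
result. -/
structure CircuitDistinguisher (ℓ N : ℕ) extends CircuitMachine ℓ N where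
  final : Fin 4 → Circuit (Fin (m + 2))

/-- The distinguisher described by the circuits. -/
def CircuitDistinguisher.toDistinguisher {ℓ N : ℕ} (D : CircuitDistinguisher ℓ N) :
    Distinguisher ℓ N D.Mem where
  toMachine := D.toCircuitMachine.toMachine
  accept k := acceptEffect (D.final k) 0
  accept_effect k := acceptEffect_effect (D.final k) 0

/-- The size: number of qubits plus number of rounds plus number of gates. -/
def CircuitDistinguisher.size {ℓ N : ℕ} (D : CircuitDistinguisher ℓ N) : ℕ :=
  D.toCircuitMachine.size + ∑ k, (D.final k).length

/-- A distinguisher, given by circuits, for resources that output a classical value on the left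
interface and a qubit on the right interface: having obtained `k`, it runs the circuit `final k` on
that qubit, which is put on wire `0`, and `m` further qubits in the state `|0…0⟩`, measures wire `0`
and outputs the result. -/
structure CircuitTest where
  m : ℕ
  final : Fin 4 → Circuit (Fin (m + 1))

/-- The effects on the qubit described by the circuits. -/
def CircuitTest.effect (T : CircuitTest) (k : Fin 4) : Matrix Bool Bool ℂ :=
  (qubitIso T.m)ᴴ * acceptEffect (T.final k) 0 * qubitIso T.m

/-- The size: number of qubits plus number of gates. -/
def CircuitTest.size (T : CircuitTest) : ℕ :=
  T.m + 1 + ∑ k, (T.final k).length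

/-! ### Realizability against polynomially bounded distinguishers -/

/-- The sequence is bounded by a polynomial in the security parameter. -/
def PolyBounded (f : ℕ → ℕ) : Prop :=
  ∃ p : Polynomial ℕ, ∀ n, f n ≤ p.eval n

/-- `S` is `ε`-classically-realizable in the computational sense, where `ε` may depend on the security
parameter `n`: all systems are (non-uniform) families of circuits of polynomial size, and against
each polynomial-size family of distinguishers, for all sufficiently large `n`, availability and
security hold within `ε n`. -/
def CompRealizable (S : IdealResource) (ε : ℕ → ℝ) : Prop :=
  ∃ (ℓ N : ℕ → ℕ) (πA πB : ∀ n, CircuitMachine (ℓ n) (N n)),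
    PolyBounded (fun n => (πA n).size) ∧ PolyBounded (fun n => (πB n).size) ∧
    (∀ T : ℕ → CircuitTest, PolyBounded (fun n => (T n).size) →
      ∀ᶠ n in Filter.atTop,
        |cqProb (T n).effect ((πA n).toClient.link.attach (πB n).toServer)
          - cqProb (T n).effect S.state| ≤ ε n) ∧
    ∃ σ : ∀ n, CircuitMachine (ℓ n) (N n), PolyBounded (fun n => (σ n).size) ∧
      ∀ D : ∀ n, CircuitDistinguisher (ℓ n) (N n), PolyBounded (fun n => (D n).size) →
        ∀ᶠ n in Filter.atTop,
          |(D n).toDistinguisher.prob (πA n).toClient.link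
            - (D n).toDistinguisher.prob (S.link (σ n).toSimulator)| ≤ ε n

end RSP

end

namespace RSP

/-! ### Positivity and linearity of machines -/

/-! A simulator reaches the distinguisher only through classical messages, so whatever it does with
the qubit `|+_θ⟩` amounts to a measurement. Let the distinguisher run the honest server on these
messages, take the qubit that the server would output and, once `θ` is known, project it onto
`|+_θ⟩`. Against the ideal resource with a simulator this is a measure-and-prepare strategy for four
states forming two mutually unbiased bases; it succeeds with probability at most `1/2 + √2/4 < 7/8`.
The test is certain on `S`, so by availability it succeeds with probability at least `1 - ε` against
the real client. Security then gives `1 - ε ≤ 7/8 + ε`, that is `ε ≥ 1/16` (`le_of_realized`).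

The bound `7/8` (`prob_ideal_le`) is obtained transcript by transcript. For fixed messages the
probability is a product of a simulator factor `f k` and a server factor `t k`. Antipodal projectors
sum to the identity (`plusProj_angle_add_antipode`), hence `f 0 + f 2 = f 1 + f 3`; the `t k` are
given by two Bloch coordinates in a disc (`exists_overlaps_plusProj`). `measure_prepare_le` combines
both facts, and `Machine.sum_run_re_trace_mul` computes the total weight of all transcripts.

It remains to see that the distinguisher is admissible. In the unbounded case its final effect is
the pullback of the projector along the server's output channel (`dual_effect`). In the
computational case the projection is implemented exactly by at most 13 gates for each angle
(`acceptEffect_testCircuit`). -/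

lemma IsCP.posSemidef_map {H O : Type} {Φ : Matrix H H ℂ →ₗ[ℂ] Matrix O O ℂ} (hΦ : IsCP Φ)
    {X : Matrix H H ℂ} (hX : X.PosSemidef) : (Φ X).PosSemidef :=
  (hΦ 1 _ (hX.submatrix Prod.snd)).submatrix fun o : O => ((0 : Fin 1), o)

lemma Machine.run_add {ℓ N : ℕ} {I H : Type} [Fintype I] [Fintype H] (M : Machine ℓ N I H)
    (ρ ρ' : Matrix I I ℂ) (recv sent : Fin N → Msg ℓ) :
    M.run (ρ + ρ') recv sent = M.run ρ recv sent + M.run ρ' recv sent := by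
  have key : ∀ (n : ℕ) (f : Fin n → (Matrix H H ℂ →ₗ[ℂ] Matrix H H ℂ)) (a b : Matrix H H ℂ),
      Fin.foldl n (fun s i => f i s) (a + b) =
        Fin.foldl n (fun s i => f i s) a + Fin.foldl n (fun s i => f i s) b := by
    intro n
    induction n with
    | zero => intros; simp
    | succ n ih => intro f a b; simp only [Fin.foldl_succ_last, ih fun i => f i.castSucc, map_add]
  simp only [Machine.run, map_add]
  exact key N (fun i => M.step i (recv i) (sent i)) _ _

lemma Machine.run_smul {ℓ N : ℕ} {I H : Type} [Fintype I] [Fintype H] (M : Machine ℓ N I H)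
    (c : ℂ) (ρ : Matrix I I ℂ) (recv sent : Fin N → Msg ℓ) :
    M.run (c • ρ) recv sent = c • M.run ρ recv sent := by
  have key : ∀ (n : ℕ) (f : Fin n → (Matrix H H ℂ →ₗ[ℂ] Matrix H H ℂ)) (a : Matrix H H ℂ),
      Fin.foldl n (fun s i => f i s) (c • a) = c • Fin.foldl n (fun s i => f i s) a := by
    intro n
    induction n with
    | zero => intros; simp
    | succ n ih => intro f a; simp only [Fin.foldl_succ_last, ih fun i => f i.castSucc, map_smul]
  simp only [Machine.run, map_smul]
  exact key N (fun i => M.step i (recv i) (sent i)) _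

lemma Machine.run_posSemidef {ℓ N : ℕ} {I H : Type} [Fintype I] [Fintype H]
    (M : Machine ℓ N I H) {ρ : Matrix I I ℂ} (hρ : ρ.PosSemidef) (recv sent : Fin N → Msg ℓ) :
    (M.run ρ recv sent).PosSemidef := by
  have key : ∀ (n : ℕ) (f : Fin n → (Matrix H H ℂ →ₗ[ℂ] Matrix H H ℂ)) (_ : ∀ i, IsCP (f i))
      (a : Matrix H H ℂ) (_ : a.PosSemidef), (Fin.foldl n (fun s i => f i s) a).PosSemidef := by
    intro n
    induction n with
    | zero => intro f _ a ha; simpa using ha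
    | succ n ih =>
      intro f hf a ha
      rw [Fin.foldl_succ_last]
      exact (hf _).posSemidef_map (ih (fun i => f i.castSucc) (fun i => hf _) a ha)
  exact key N (fun i => M.step i (recv i) (sent i))
    (fun i => (M.step_instrument i _).1 _) _ (M.init_channel.1.posSemidef_map hρ)

/-! ### The total probability of all transcripts -/

lemma delayed_snoc_castSucc {ℓ N : ℕ} (y : Fin N → Msg ℓ) (b : Msg ℓ) (i : Fin N) :
    delayed (Fin.snoc y b : Fin (N + 1) → Msg ℓ) i.castSucc = delayed y i := by
  unfold delayed
  rw [Fin.cons_snoc_eq_snoc_cons, Fin.snoc_castSucc]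

/-- Causality: the last message of the right side comes too late to influence the left side. -/
lemma delayed_snoc_last {ℓ N : ℕ} (y : Fin N → Msg ℓ) (b b' : Msg ℓ) :
    delayed (Fin.snoc y b : Fin (N + 1) → Msg ℓ) (Fin.last N) =
      delayed (Fin.snoc y b' : Fin (N + 1) → Msg ℓ) (Fin.last N) := by
  unfold delayed
  simp only [Fin.cons_snoc_eq_snoc_cons, Fin.snoc_castSucc]

/-- Peel off the last round. The final answer of the right side affects no factor but its own, so
summing over it first uses up trace preservation of `g`; the final message of the left side can then
be summed out by that of `f`. What is left is the same sum with one round fewer. -/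
lemma sum_foldl_trace_mul {ℓ : ℕ} {H K : Type} [Fintype H] [Fintype K] (N : ℕ)
    (f : Fin N → Msg ℓ → Msg ℓ → (Matrix H H ℂ →ₗ[ℂ] Matrix H H ℂ))
    (g : Fin N → Msg ℓ → Msg ℓ → (Matrix K K ℂ →ₗ[ℂ] Matrix K K ℂ))
    (hf : ∀ i x, IsInstrument (f i x)) (hg : ∀ i x, IsInstrument (g i x))
    (a : Matrix H H ℂ) (b : Matrix K K ℂ) :
    ∑ x : Fin N → Msg ℓ, ∑ y : Fin N → Msg ℓ,
      (Fin.foldl N (fun s i => f i (delayed y i) (x i) s) a).trace *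
        (Fin.foldl N (fun s i => g i (x i) (y i) s) b).trace = a.trace * b.trace := by
  induction N with
  | zero => simp
  | succ N ih =>
    rw [← ih (fun i => f i.castSucc) (fun i => g i.castSucc) (fun _ => hf _) (fun _ => hg _)]
    simp only [← (Fin.snocEquiv fun _ : Fin (N + 1) => Msg ℓ).sum_comp, Fintype.sum_prod_type]
    rw [Finset.sum_comm]
    refine Finset.sum_congr rfl fun x _ => ?_
    rw [Finset.sum_congr rfl fun _ _ => Finset.sum_comm, Finset.sum_comm]
    refine Finset.sum_congr rfl fun y _ => ?_
    simp only [Fin.snocEquiv, Equiv.coe_fn_mk, Fin.foldl_succ_last, Fin.snoc_castSucc,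
      Fin.snoc_last, delayed_snoc_castSucc]
    -- Replacing `b` by the dummy message in the left factor makes that factor constant in `b`, so
    -- it can be pulled out of the sum over `b`.
    rw [Finset.sum_congr rfl fun _ _ => Finset.sum_congr rfl fun b _ => by
      rw [delayed_snoc_last y b fun _ => false]]
    simp_rw [← Finset.mul_sum, (hg _ _).2, ← Finset.sum_mul, (hf _ _).2]

lemma Machine.sum_run_trace_mul {ℓ N : ℕ} {I J H K : Type} [Fintype I] [Fintype J] [Fintype H]
    [Fintype K] (L : Machine ℓ N I H) (R : Machine ℓ N J K) (ρ : Matrix I I ℂ)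
    (τ : Matrix J J ℂ) :
    ∑ x : Fin N → Msg ℓ, ∑ y : Fin N → Msg ℓ,
      (L.run ρ (delayed y) x).trace * (R.run τ x y).trace = ρ.trace * τ.trace := by
  rw [← L.init_channel.2 ρ, ← R.init_channel.2 τ]
  exact sum_foldl_trace_mul N L.step R.step L.step_instrument R.step_instrument _ _

lemma _root_.Matrix.PosSemidef.ofReal_re_trace {H : Type} [Fintype H] {X : Matrix H H ℂ}
    (hX : X.PosSemidef) : ((X.trace.re : ℝ) : ℂ) = X.trace :=
  (Complex.eq_re_of_ofReal_le (r := 0) (by simpa using hX.trace_nonneg)).symm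

/-- Real parts are multiplicative here because all traces involved are traces of positive
semidefinite matrices, hence real. -/
lemma Machine.sum_run_re_trace_mul {ℓ N : ℕ} {I J H K : Type} [Fintype I] [Fintype J] [Fintype H]
    [Fintype K] (L : Machine ℓ N I H) (R : Machine ℓ N J K) {ρ : Matrix I I ℂ}
    {τ : Matrix J J ℂ} (hρ : ρ.PosSemidef) (hτ : τ.PosSemidef) :
    ∑ x : Fin N → Msg ℓ, ∑ y : Fin N → Msg ℓ,
      (L.run ρ (delayed y) x).trace.re * (R.run τ x y).trace.re = ρ.trace.re * τ.trace.re := by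
  have h := L.sum_run_trace_mul R ρ τ
  rw [← hρ.ofReal_re_trace, ← hτ.ofReal_re_trace, Finset.sum_congr rfl fun x _ =>
    Finset.sum_congr rfl fun y _ => by
      rw [← (L.run_posSemidef hρ (delayed y) x).ofReal_re_trace,
        ← (R.run_posSemidef hτ x y).ofReal_re_trace]] at h
  exact_mod_cast h

/-! ### The four states -/

/-- `e^{ikπ/2} = i^k`. -/
lemma exp_angle (k : Fin 4) : Complex.exp (angle k * Complex.I) = Complex.I ^ (k : ℕ) := by
  conv_rhs => rw [← Complex.exp_pi_div_two_mul_I]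
  rw [← Complex.exp_nat_mul]
  congr 1
  push_cast [angle]
  ring

lemma invSqrtTwo_mul_self : ((1 / √2 : ℝ) : ℂ) * ((1 / √2 : ℝ) : ℂ) = 1 / 2 := by
  rw [← Complex.ofReal_mul, ← pow_two, div_pow, Real.sq_sqrt (by norm_num)]
  norm_num

/-- The entries of `|+_θ⟩⟨+_θ|` for `θ = kπ/2`. -/
lemma plusProj_angle_apply (k : Fin 4) (a b : Bool) :
    plusProj (angle k) a b =
      1 / 2 * ((if a then Complex.I ^ (k : ℕ) else 1) *
        (if b then (-Complex.I) ^ (k : ℕ) else 1)) := by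
  have h := invSqrtTwo_mul_self
  cases a <;> cases b <;>
    simp only [plusProj, Matrix.vecMulVec_apply, Pi.star_apply, plusKet, RCLike.star_def, map_mul,
      map_pow, Complex.conj_I, Complex.conj_ofReal, exp_angle, if_true, Bool.false_eq_true,
      if_false] <;> rw [← h] <;> ring

/-- Each antipodal pair is an orthonormal basis. Consequently no measurement outcome can be more
likely on the average over one basis than over the other. -/
lemma plusProj_angle_add_antipode :
    plusProj (angle 0) + plusProj (angle 2) = 1 ∧ plusProj (angle 1) + plusProj (angle 3) = 1 := by
  have h2 := Complex.I_sq
  constructor <;> ext a b <;> rw [Matrix.add_apply, plusProj_angle_apply, plusProj_angle_apply] <;>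
    cases a <;> cases b <;> simp <;> grind

/-- The overlaps of a positive qubit operator with the four states lie on a circle. -/
lemma exists_overlaps_plusProj {τ : Matrix Bool Bool ℂ} (hτ : τ.PosSemidef) :
    ∃ u v : ℝ, u ^ 2 + v ^ 2 ≤ (τ.trace.re / 2) ^ 2 ∧
      (plusProj (angle 0) * τ).trace.re = τ.trace.re / 2 + u ∧
      (plusProj (angle 2) * τ).trace.re = τ.trace.re / 2 - u ∧
      (plusProj (angle 1) * τ).trace.re = τ.trace.re / 2 + v ∧
      (plusProj (angle 3) * τ).trace.re = τ.trace.re / 2 - v := by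
  have hconj : τ true false = star (τ false true) := (hτ.1.apply true false).symm
  have him : ∀ b, (τ b b).im = 0 := fun b => (Complex.le_def.1 (hτ.diag_nonneg (i := b))).2.symm
  -- Nonnegativity of the determinant bounds the squared modulus of the off-diagonal entry by the
  -- product of the diagonal entries, which is at most `(tr τ / 2)²`. The witnesses below are the
  -- Bloch coordinates of `τ` in the equatorial plane.
  have hdet := (Complex.le_def.1 (hτ.submatrix finTwoEquiv).det_nonneg).1
  rw [Matrix.det_fin_two] at hdet
  simp [finTwoEquiv, hconj, him] at hdet
  refine ⟨(τ false true).re, -(τ false true).im, ?_, ?_, ?_, ?_, ?_⟩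
  · simp [Matrix.trace]
    nlinarith [sq_nonneg ((τ true true).re - (τ false false).re)]
  all_goals
    simp [Matrix.trace, Matrix.mul_apply, plusProj_angle_apply, hconj, him, pow_succ]
    ring

/-- The success probability of measuring the state and preparing another one. -/
lemma measure_prepare_le {f t : Fin 4 → ℝ} {s T u v : ℝ} (hf : ∀ k, 0 ≤ f k) (hT : 0 ≤ T)
    (h02 : f 0 + f 2 = s) (h13 : f 1 + f 3 = s) (huv : u ^ 2 + v ^ 2 ≤ (T / 2) ^ 2)
    (h0 : t 0 = T / 2 + u) (h2 : t 2 = T / 2 - u) (h1 : t 1 = T / 2 + v) (h3 : t 3 = T / 2 - v) :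
    ∑ k, f k * t k ≤ 7 / 4 * (s * T) := by
  have hs : 0 ≤ s := h02 ▸ add_nonneg (hf 0) (hf 2)
  -- The sharp constant is `√2/2`; the rational `3/4` is slightly larger and is what turns the
  -- optimal success probability into `7/8`.
  have habs : |u| + |v| ≤ 3 / 4 * T := by
    refine abs_le_of_sq_le_sq' ?_ (by positivity) |>.2
    nlinarith [sq_nonneg (|u| - |v|), sq_abs u, sq_abs v, sq_nonneg T]
  -- Nonnegative numbers with sum `s` differ by at most `s`.
  have hu : (f 0 - f 2) * u ≤ s * |u| := by
    refine (le_abs_self _).trans ?_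
    rw [abs_mul]
    exact mul_le_mul_of_nonneg_right (abs_le.2 ⟨by linarith [hf 0], by linarith [hf 2]⟩)
      (abs_nonneg _)
  have hv : (f 1 - f 3) * v ≤ s * |v| := by
    refine (le_abs_self _).trans ?_
    rw [abs_mul]
    exact mul_le_mul_of_nonneg_right (abs_le.2 ⟨by linarith [hf 1], by linarith [hf 3]⟩)
      (abs_nonneg _)
  have hm := mul_le_mul_of_nonneg_left habs hs
  have hsum : ∑ k, f k * t k = s * T + (f 0 - f 2) * u + (f 1 - f 3) * v := by
    rw [Fin.sum_univ_four, h0, h1, h2, h3]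
    linear_combination T / 2 * (h02 + h13)
  linarith

/-! ### The distinguisher that runs the server and tests the output qubit -/

/-- With a simulator, the test succeeds with probability at most `7/8`: the messages exchanged
between simulator and distinguisher are a measurement of the qubit of the ideal resource. -/
lemma prob_ideal_le {ℓ N : ℕ} {H K : Type} [Fintype H] [Fintype K] [DecidableEq K]
    (σ : Simulator ℓ N H) (D : Distinguisher ℓ N K) (out : Matrix K K ℂ →ₗ[ℂ] Matrix Bool Bool ℂ)
    (hout : IsChannel out)
    (hD : ∀ k ρ, (D.accept k * ρ).trace = (plusProj (angle k) * out ρ).trace) :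
    D.prob (SZpi2.link σ) ≤ 7 / 8 := by
  have h1 : ((1 : Matrix Bool Bool ℂ).trace).re = 2 := by simp
  have h1' : ((1 : Matrix Unit Unit ℂ).trace).re = 1 := by simp
  -- The simulator is fed the unnormalised operator `1`, the sum of either antipodal pair, so the
  -- transcripts have total weight `2`.
  have htot := σ.sum_run_re_trace_mul D.toMachine
    (Matrix.PosSemidef.one : (1 : Matrix Bool Bool ℂ).PosSemidef)
    (Matrix.PosSemidef.one : (1 : Matrix Unit Unit ℂ).PosSemidef)
  rw [h1, h1', mul_one] at htot
  -- The factor `7/16` is the prior probability `1/4` of each angle times the constant `7/4` of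
  -- `measure_prepare_le`.
  have key : ∀ x y : Fin N → Msg ℓ,
      ∑ k, SZpi2.link σ k x y * (D.accept k * D.run 1 x y).trace.re ≤
        7 / 16 * ((σ.run 1 (delayed y) x).trace.re * (D.run 1 x y).trace.re) := by
    intro x y
    have hR := D.run_posSemidef (Matrix.PosSemidef.one : (1 : Matrix Unit Unit ℂ).PosSemidef) x y
    have hτ := hout.1.posSemidef_map hR
    obtain ⟨u, v, huv, h0, h2, h1, h3⟩ := exists_overlaps_plusProj hτ
    have hadd : ∀ j k : Fin 4, plusProj (angle j) + plusProj (angle k) = 1 →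
        (σ.run (plusProj (angle j)) (delayed y) x).trace.re +
          (σ.run (plusProj (angle k)) (delayed y) x).trace.re =
            (σ.run 1 (delayed y) x).trace.re := fun j k h => by
      rw [← h, σ.run_add, Matrix.trace_add, Complex.add_re]
    have hle := measure_prepare_le
      (f := fun k => (σ.run (plusProj (angle k)) (delayed y) x).trace.re)
      (t := fun k => (plusProj (angle k) * out (D.run 1 x y)).trace.re)
      (fun k => (Complex.le_def.1 (σ.run_posSemidef (plusProj_posSemidef _) _ _).trace_nonneg).1)
      (Complex.le_def.1 hτ.trace_nonneg).1
      (hadd 0 2 plusProj_angle_add_antipode.1) (hadd 1 3 plusProj_angle_add_antipode.2)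
      huv h0 h2 h1 h3
    rw [hout.2] at hle
    have hq : ∀ k, SZpi2.link σ k x y * (D.accept k * D.run 1 x y).trace.re =
        1 / 4 * ((σ.run (plusProj (angle k)) (delayed y) x).trace.re *
          (plusProj (angle k) * out (D.run 1 x y)).trace.re) := fun k => by
      rw [hD, IdealResource.link, SZpi2, σ.run_smul, Matrix.trace_smul, smul_eq_mul,
        show (1 / 4 : ℂ) = ((1 / 4 : ℝ) : ℂ) by norm_num, Complex.re_ofReal_mul, mul_assoc]
    simp_rw [hq, ← Finset.mul_sum]
    linarith
  calc D.prob (SZpi2.link σ)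
      = ∑ x : Fin N → Msg ℓ, ∑ y : Fin N → Msg ℓ,
          ∑ k, SZpi2.link σ k x y * (D.accept k * D.run 1 x y).trace.re := by
        rw [Distinguisher.prob, Finset.sum_comm]
        exact Finset.sum_congr rfl fun x _ => Finset.sum_comm
    _ ≤ ∑ x : Fin N → Msg ℓ, ∑ y : Fin N → Msg ℓ,
          7 / 16 * ((σ.run 1 (delayed y) x).trace.re * (D.run 1 x y).trace.re) :=
        Finset.sum_le_sum fun x _ => Finset.sum_le_sum fun y _ => key x y
    _ = 7 / 8 := by
        simp_rw [← Finset.mul_sum]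
        rw [htot]
        norm_num

/-- Running the server and then testing its output is the same as a distinguisher that contains the
server. -/
lemma cqProb_attach {ℓ N : ℕ} {K : Type} [Fintype K] [DecidableEq K] (p : LinkBehaviour ℓ N)
    (πB : Server ℓ N K) (D : Distinguisher ℓ N K) (E : Fin 4 → Matrix Bool Bool ℂ)
    (hDB : D.toMachine = πB.toMachine)
    (hD : ∀ k ρ, (D.accept k * ρ).trace = (E k * πB.output ρ).trace) :
    cqProb E (p.attach πB) = D.prob p := by
  refine Finset.sum_congr rfl fun k _ => ?_
  simp only [LinkBehaviour.attach, Matrix.mul_sum, Matrix.trace_sum, Complex.re_sum,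
    Matrix.mul_smul, Matrix.trace_smul, smul_eq_mul, Complex.re_ofReal_mul, hD, hDB]

lemma plusProj_mul_self (θ : ℝ) : (plusProj θ * plusProj θ).trace = 1 := by
  have h := plusProj_trace θ
  rw [plusProj, Matrix.trace_vecMulVec] at h
  rw [plusProj, Matrix.vecMulVec_mul_vecMulVec, dotProduct_comm, h, one_smul,
    Matrix.trace_vecMulVec, h]

/-- The test never rejects the ideal qubit, since each projector is applied to its own pure state.
-/
lemma cqProb_plusProj_SZpi2 : cqProb (fun k => plusProj (angle k)) SZpi2.state = 1 := by
  simp [cqProb, SZpi2, Matrix.trace_smul, plusProj_mul_self]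

/-- Availability and security for the test distinguisher imply `ε ≥ 1/16`. -/
lemma le_of_realized {ℓ N : ℕ} {G H K : Type} [Fintype G] [DecidableEq G] [Fintype H] [Fintype K]
    [DecidableEq K] (πA : Client ℓ N G) (πB : Server ℓ N K) (σ : Simulator ℓ N H)
    (D : Distinguisher ℓ N K) (hDB : D.toMachine = πB.toMachine)
    (hD : ∀ k ρ, (D.accept k * ρ).trace = (plusProj (angle k) * πB.output ρ).trace) {ε : ℝ}
    (havail : |cqProb (fun k => plusProj (angle k)) (πA.link.attach πB)
      - cqProb (fun k => plusProj (angle k)) SZpi2.state| ≤ ε)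
    (hsec : |D.prob πA.link - D.prob (SZpi2.link σ)| ≤ ε) : 1 / 16 ≤ ε := by
  rw [cqProb_plusProj_SZpi2, cqProb_attach _ πB D _ hDB hD] at havail
  have h := prob_ideal_le σ D πB.output πB.output_channel hD
  have h1 := (abs_le.1 havail).1
  have h2 := (abs_le.1 hsec).2
  -- Here `1 - ε ≤ D.prob πA.link ≤ 7/8 + ε`.
  linarith

/-! ### Unbounded distinguishers -/

open scoped MatrixOrder Matrix.Norms.L2Operator in
-- Write `A = C* C`; by cyclicity the trace is that of the positive semidefinite matrix `C B C*`.
lemma trace_mul_nonneg {H : Type} [Fintype H] [DecidableEq H] {A B : Matrix H H ℂ}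
    (hA : A.PosSemidef) (hB : B.PosSemidef) : 0 ≤ (A * B).trace := by
  obtain ⟨C, rfl⟩ := CStarAlgebra.nonneg_iff_eq_star_mul_self.1 hA.nonneg
  rw [Matrix.mul_assoc, Matrix.trace_mul_comm]
  exact (hB.mul_mul_conjTranspose_same C).trace_nonneg

/-- The dual of a linear map between matrix algebras, for the pairing `tr (E ρ)`. -/
def dual {H O : Type} [DecidableEq H] [Fintype O] (Φ : Matrix H H ℂ →ₗ[ℂ] Matrix O O ℂ)
    (E : Matrix O O ℂ) : Matrix H H ℂ :=
  Matrix.of fun i j => (E * Φ (Matrix.single j i 1)).trace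

/-- On matrix units this is the definition of `dual`; both sides are linear in `ρ`. -/
lemma trace_dual_mul {H O : Type} [Fintype H] [DecidableEq H] [Fintype O]
    (Φ : Matrix H H ℂ →ₗ[ℂ] Matrix O O ℂ) (E : Matrix O O ℂ) (ρ : Matrix H H ℂ) :
    (dual Φ E * ρ).trace = (E * Φ ρ).trace := by
  conv_rhs => rw [Matrix.matrix_eq_sum_single ρ]
  have h : ∀ i j, Matrix.single i j (ρ i j) = ρ i j • Matrix.single i j (1 : ℂ) := by simp
  simp_rw [h, map_sum, map_smul, Matrix.mul_sum, Matrix.trace_sum, Matrix.mul_smul,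
    Matrix.trace_smul]
  rw [Finset.sum_comm, Matrix.trace]
  simp only [Matrix.diag_apply, Matrix.mul_apply, smul_eq_mul]
  exact Finset.sum_congr rfl fun i _ => Finset.sum_congr rfl fun j _ => mul_comm _ _

/-- The quadratic form of `dual Φ E` at `v` is the pairing of `E` with the image under `Φ` of the
rank-one operator `v v*`, and both of these are positive. -/
lemma dual_posSemidef {H O : Type} [Fintype H] [DecidableEq H] [Fintype O] [DecidableEq O]
    {Φ : Matrix H H ℂ →ₗ[ℂ] Matrix O O ℂ} (hΦ : IsCP Φ) {E : Matrix O O ℂ}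
    (hE : E.PosSemidef) : (dual Φ E).PosSemidef := by
  have h : ∀ v : H → ℂ, 0 ≤ star v ⬝ᵥ (dual Φ E *ᵥ v) := by
    intro v
    rw [dotProduct_comm, ← Matrix.trace_vecMulVec, ← Matrix.mul_vecMulVec, trace_dual_mul]
    exact trace_mul_nonneg hE (hΦ.posSemidef_map (Matrix.posSemidef_vecMulVec_self_star v))
  -- Over `ℂ` a real nonnegative quadratic form already forces the matrix to be Hermitian.
  rw [← Matrix.isPositive_toEuclideanLin_iff, LinearMap.isPositive_iff_complex]
  intro x
  obtain ⟨hre, him⟩ := Complex.le_def.1 (h x.ofLp)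
  have hi : inner ℂ ((dual Φ E).toEuclideanLin x) x = star x.ofLp ⬝ᵥ (dual Φ E *ᵥ x.ofLp) := by
    rw [← inner_conj_symm, EuclideanSpace.inner_eq_star_dotProduct, Matrix.ofLp_toLpLin,
      Matrix.toLin'_apply, dotProduct_comm]
    exact Complex.conj_eq_iff_im.2 him.symm
  rw [hi]
  exact ⟨Complex.ext rfl him, hre⟩

/-- The dual of a trace-preserving map is unital, so it commutes with taking complements of effects.
-/
lemma dual_effect {H O : Type} [Fintype H] [DecidableEq H] [Fintype O] [DecidableEq O]
    {Φ : Matrix H H ℂ →ₗ[ℂ] Matrix O O ℂ} (hΦ : IsChannel Φ) {E : Matrix O O ℂ}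
    (hE : IsEffect E) : IsEffect (dual Φ E) := by
  refine ⟨dual_posSemidef hΦ.1 hE.1, ?_⟩
  have : 1 - dual Φ E = dual Φ (1 - E) := by
    ext i j
    rcases eq_or_ne i j with rfl | hij
    · simp [dual, Matrix.sub_mul, hΦ.2, Matrix.trace_single_eq_same]
    · simp [dual, Matrix.sub_mul, hΦ.2, Matrix.trace_single_eq_of_ne _ _ _ hij.symm, hij]
  rw [this]
  exact dual_posSemidef hΦ.1 hE.2

lemma plusProj_effect (k : Fin 4) : IsEffect (plusProj (angle k)) := by
  refine ⟨plusProj_posSemidef _, ?_⟩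
  obtain ⟨h02, h13⟩ := plusProj_angle_add_antipode
  fin_cases k
  · exact eq_sub_of_add_eq' h02 ▸ plusProj_posSemidef _
  · exact eq_sub_of_add_eq' h13 ▸ plusProj_posSemidef _
  · exact eq_sub_of_add_eq h02 ▸ plusProj_posSemidef _
  · exact eq_sub_of_add_eq h13 ▸ plusProj_posSemidef _

lemma not_itRealizable {ε : ℝ} (hε : ε < 1 / 16) : ¬ ITRealizable SZpi2 ε := by
  rintro ⟨ℓ, N, dA, dB, πA, πB, havail, dS, σ, hsec⟩
  -- The honest server, with its output channel absorbed into the accepting effects.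
  let D : Distinguisher ℓ N (Fin dB) :=
    { πB.toMachine with
      accept := fun k => dual πB.output (plusProj (angle k))
      accept_effect := fun k => dual_effect πB.output_channel (plusProj_effect k) }
  exact hε.not_ge (le_of_realized πA πB σ D rfl (fun k ρ => trace_dual_mul _ _ ρ)
    (havail _ plusProj_effect) (hsec dB D))

/-! ### Circuits -/

/-- The circuit that maps `|+_θ⟩` on wire `0`, for `θ = kπ/2`, to `|1⟩`. -/
def testCircuit (n : ℕ) (k : Fin 4) : Circuit (Fin (n + 1)) :=
  List.replicate (12 - 2 * (k : ℕ)) (.t 0) ++ [.had 0]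

lemma mat_replicate_t {W : Type} [DecidableEq W] [Fintype W] (w : W) (c : Circuit W) (r : ℕ) :
    Circuit.mat (List.replicate r (.t w) ++ c) = Circuit.mat c *
      Matrix.diagonal fun f : W → Bool =>
        if f w then Complex.exp ((Real.pi / 4 : ℝ) * Complex.I) ^ r else 1 := by
  induction r with
  | zero => simp
  | succ r ih =>
    rw [List.replicate_succ, List.cons_append, Circuit.mat, ih, Gate.mat, Matrix.mul_assoc,
      Matrix.diagonal_mul_diagonal]
    congr 2
    ext f
    split_ifs
    · rw [pow_succ]
    · simp

/-- The phase gates must turn `|+_θ⟩` into `|-⟩`, which Hadamard sends to `|1⟩`; the phase needed is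
`-e^{-iθ}`. The exponent `4 - 2k` would do modulo `8`; adding a full period keeps the natural
subtraction from truncating. -/
lemma exp_pi_div_four_pow (k : Fin 4) :
    Complex.exp ((Real.pi / 4 : ℝ) * Complex.I) ^ (12 - 2 * (k : ℕ)) =
      -(-Complex.I) ^ (k : ℕ) := by
  have h : Complex.exp ((Real.pi / 4 : ℝ) * Complex.I) ^ 2 = Complex.I := by
    conv_rhs => rw [← Complex.exp_pi_div_two_mul_I]
    rw [← Complex.exp_nat_mul]
    congr 1
    push_cast
    ring
  rw [show 12 - 2 * (k : ℕ) = 2 * (6 - k) by omega, pow_mul, h]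
  have h2 := Complex.I_sq
  fin_cases k
  all_goals simp
  all_goals grind

/-- All gates act on wire `0`, so the effect is the projector on that wire tensored with the
identity; equality of tails is the identity on the other wires. -/
lemma acceptEffect_testCircuit (n : ℕ) (k : Fin 4) :
    acceptEffect (testCircuit n k) 0 = Matrix.of fun f g : Fin (n + 1) → Bool =>
      if Fin.tail f = Fin.tail g then plusProj (angle k) (f 0) (g 0) else 0 := by
  have hU : ∀ f g : Fin (n + 1) → Bool, Circuit.mat (testCircuit n k) f g =
      if Fin.tail f = Fin.tail g then
        hadEntry (f 0) (g 0) * (if g 0 then -(-Complex.I) ^ (k : ℕ) else 1) else 0 := by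
    intro f g
    have htail : f = Function.update g 0 (f 0) ↔ Fin.tail f = Fin.tail g := by
      refine ⟨fun h => by rw [h, Fin.tail_update_zero], fun h => ?_⟩
      rw [← Fin.cons_self_tail f, ← Fin.cons_self_tail g, h, Fin.update_cons_zero, Fin.cons_zero]
    rw [testCircuit, mat_replicate_t, Matrix.mul_diagonal, exp_pi_div_four_pow, Circuit.mat,
      Circuit.mat, Matrix.one_mul, Gate.mat, Matrix.of_apply, ite_mul, zero_mul]
    simp only [htail]
  ext f g
  have hs : ((√2 : ℝ) : ℂ)⁻¹ * ((√2 : ℝ) : ℂ)⁻¹ = 2⁻¹ := by simpa using invSqrtTwo_mul_self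
  rw [acceptEffect, basisProj, Matrix.mul_apply]
  simp only [Matrix.mul_diagonal, Matrix.conjTranspose_apply, hU, Matrix.of_apply,
    plusProj_angle_apply]
  rw [← (Fin.consEquiv fun _ : Fin (n + 1) => Bool).sum_comp, Fintype.sum_prod_type]
  simp only [Fin.consEquiv, Equiv.coe_fn_mk, Fin.tail_cons, Fin.cons_zero, Fintype.sum_bool]
  by_cases hfg : Fin.tail f = Fin.tail g
  · rw [Finset.sum_eq_single (Fin.tail g), Finset.sum_eq_zero]
    · rcases f 0 <;> rcases g 0 <;> simp [hadEntry, hfg] <;> grind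
    · simp
    · intro r _ hr
      simp [hr]
    · simp
  · rw [if_neg hfg, Finset.sum_eq_zero, Finset.sum_eq_zero, add_zero]
    · simp
    · intro r _
      rcases eq_or_ne r (Fin.tail f) with rfl | hr
      · simp [hfg]
      · simp [hr]

lemma effect_testCircuit (k : Fin 4) :
    CircuitTest.effect ⟨0, testCircuit 0⟩ k = plusProj (angle k) := by
  ext a b
  rw [CircuitTest.effect, acceptEffect_testCircuit]
  simp only [qubitIso, Matrix.mul_apply, Matrix.conjTranspose_apply, Matrix.of_apply,
    apply_ite star, star_one, star_zero, ite_mul, one_mul, zero_mul, mul_ite, mul_one, mul_zero,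
    Finset.sum_ite_eq', Finset.mem_univ, if_true]
  rw [Finset.sum_eq_single (Fin.cons a fun _ => false)]
  · simp
  · intro f _ hf
    simp [hf]
  · simp

/-- A projector tensored with the identity sees only the partial trace. This lets the distinguisher
test the server's output directly on its memory. -/
lemma trace_acceptEffect_testCircuit (n : ℕ) (k : Fin 4)
    (ρ : Matrix (Fin (n + 1) → Bool) (Fin (n + 1) → Bool) ℂ) :
    (acceptEffect (testCircuit n k) 0 * ρ).trace =
      (plusProj (angle k) * keepFirst n ρ).trace := by
  rw [acceptEffect_testCircuit]
  simp only [Matrix.trace, Matrix.diag_apply, Matrix.mul_apply, keepFirst, LinearMap.coe_mk,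
    AddHom.coe_mk, Matrix.of_apply]
  simp only [← (Fin.consEquiv fun _ : Fin (n + 1) => Bool).sum_comp, Fintype.sum_prod_type]
  simp only [Fin.consEquiv, Equiv.coe_fn_mk, Fin.tail_cons, Fin.cons_zero, ite_mul, zero_mul,
    Finset.sum_ite_eq, Finset.mem_univ, if_true, Fintype.sum_bool, Finset.mul_sum,
    Finset.sum_add_distrib]

lemma length_testCircuit_le (n : ℕ) (k : Fin 4) : (testCircuit n k).length ≤ 13 := by
  simp only [testCircuit, List.length_append, List.length_replicate, List.length_singleton]
  omega

lemma not_compRealizable {ε : ℕ → ℝ} (hε : ∃ᶠ n in Filter.atTop, ε n < 1 / 16) :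
    ¬ CompRealizable SZpi2 ε := by
  rintro ⟨ℓ, N, πA, πB, -, ⟨p, hp⟩, havail, σ, -, hsec⟩
  let D : ∀ n, CircuitDistinguisher (ℓ n) (N n) := fun n => ⟨πB n, testCircuit _⟩
  have hD : PolyBounded fun n => (D n).size := by
    -- The tests add at most 13 gates for each of the four angles to the size of the server.
    refine ⟨p + Polynomial.C (∑ _k : Fin 4, 13), fun n => ?_⟩
    rw [Polynomial.eval_add, Polynomial.eval_C]
    exact add_le_add (hp n) (Finset.sum_le_sum fun k _ => length_testCircuit_le _ k)
  -- The availability test is one circuit on a single wire, independent of `n`.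
  have hT : PolyBounded fun _ => CircuitTest.size ⟨0, testCircuit 0⟩ :=
    ⟨Polynomial.C _, fun n => Polynomial.eval_C.ge⟩
  -- Both bounds hold eventually and `ε n < 1/16` holds infinitely often, so all three meet at some
  -- `n`.
  obtain ⟨n, hn, h1, h2⟩ := (hε.and_eventually ((havail _ hT).and (hsec D hD))).exists
  rw [funext effect_testCircuit] at h1
  exact hn.not_ge (le_of_realized (πA n).toClient (πB n).toServer (σ n).toSimulator
    (D n).toDistinguisher rfl (fun k ρ => trace_acceptEffect_testCircuit _ k ρ) h1 h2)

end RSP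

theorem mainTheorem5 :
    ∃ η : ℝ, 0 < η ∧
      (∀ ε : ℝ, 0 ≤ ε → ε < η → ¬ RSP.ITRealizable RSP.SZpi2 ε) ∧
      (∀ ε : ℕ → ℝ, (∀ n, 0 ≤ ε n) → (∃ᶠ n in Filter.atTop, ε n < η) →
        ¬ RSP.CompRealizable RSP.SZpi2 ε) :=
  ⟨1 / 16, by norm_num, fun _ _ hε => RSP.not_itRealizable hε,
    fun _ _ hε => RSP.not_compRealizable hε⟩
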